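/- **Setting.** Let $\nu$ be a $\sigma$-finite measure on $\mathcal Z$ such that the real Hilbert space $\mathcal H=L^2(\mathcal Z,\nu)$ is separable; write $(v\otimes w)(x)=\langle v,x\rangle w$. *Errors.* $\{\varepsilon_i\}_{i\in\mathbb Z}$ is a centered, strictly stationary sequence of $\mathcal H$-valued random variables with $\mathsf E\|\varepsilon_1\|^k<\infty$ for some $k>2$. With $C_r=\mathsf E[\varepsilon_0\otimes\varepsilon_r]$, assume $\sum_{r\in\mathbb Z}\|C_r\|<\infty$ and $C_\varepsilon:=\sum_{r\in\mathbb Z}C_r\neq 0$, and assume that for some orthonormal basis $(v_p)$ of $\mathcal H$ consisting of eigenvectors of $C_\varepsilon$, $\sum_p\sum_{r\in\mathbb Z}|\mathrm{Cov}(\langle\varepsilon_0,v_p\rangle,\langle\varepsilon_r,v_p\rangle)|<\infty$. Moreover, the processes $\frac1{\sqrt n}\sum_{i=1}^{\lfloor nt\rfloor}\varepsilon_i$, $t\in[0,1]$, converge in distribution, in the Skorokhod space $D^{\mathcal H}[0,1]$ of càdlàg paths, to an $\mathcal H$-valued Brownian motion with covariance operator $C_\varepsilon$. *Model.* For each $n$,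 $X_i=X_{n,i}=\mu+\Delta_n\,g(i/n)+\varepsilon_i$ for $i=1,\dots,n$, where $\mu,\Delta_n\in\mathcal H$ are deterministic with $\sqrt n\,\|\Delta_n\|\to\infty$, and $g:[0,1]\to\mathbb R$ is non-constant, bounded, Riemann integrable, piecewise continuous (that is, $[0,1]$ can be partitioned into finitely many intervals of positive length on each of which $g$ is continuous) and satisfies $g(0)=0$. *Weight function.* $h:[-1,1]\to\mathbb R$ is non-constant and of bounded total variation, $h(x)=0$ for $x\le 0$, and there are $\alpha,\beta>0$ with $|h(t)-h(s)|\le\beta|t-s|^\alpha$ for all $s,t\in[0,1]$. *Detectability.* $$\sup_{0\le t\le 1}\left|\int_0^1 h(x-t)g(x)\,dx-\int_0^1 g(x)\,dx\int_0^1 h(x-t)\,dx\right|>0 .$$ *Statistics.* With $\bar X_n=\frac1n\sum_{i=1}^nX_i$ put $$T_{n,\mathrm{FF}}(h)=\max_{1\le k<n}\Big\|\frac1{\sqrt n}\sum_{i=1}^n h\Big(\frac{i-k}n\Big)(X_i-\bar X_n)\Big\|,$$ $$T_{n,\mathrm{WF}}(h)=\max_{1\le k<n}\Big\|(\hat C_n+\hat\lambda_{1}\mathrm{Id})^{-1/2}\,\frac1{\sqrt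 n}\sum_{i=1}^n h\Big(\frac{i-k}n\Big)(X_i-\bar X_n)\Big\|,$$ where $\hat C_n$ is a random bounded operator on $\mathcal H$ and $\hat\lambda_1=\hat\lambda_{1,n}$ is its largest eigenvalue; for a positive self-adjoint bounded operator $A$ with bounded inverse, $A^{-1/2}$ is the unique positive self-adjoint bounded operator with $A^{-1/2}AA^{-1/2}=\mathrm{Id}$. **Theorem.** In this setting $T_{n,\mathrm{FF}}(h)\to\infty$ in probability as $n\to\infty$, i.e. $\mathsf P(T_{n,\mathrm{FF}}(h)\le M)\to0$ for every $M\in\mathbb R$. If additionally $\|\hat C_n\|=o_{\mathsf P}(n\|\Delta_n\|^2)$ and, with probability tending to one, the weight is well defined (that is, $\hat C_n$ is self-adjoint with a largest eigenvalue $\hat\lambda_1$ and $\hat C_n+\hat\lambda_1\mathrm{Id}$ is positive with bounded inverse, as holds for instance whenever $\hat C_n$ is a nonzero compact positive semidefinite operator), then also $T_{n,\mathrm{WF}}(h)\to\infty$ in probability. -/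

import Mathlib

open MeasureTheory ProbabilityTheory Filter Topology Set
open scoped ENNReal NNReal InnerProductSpace

noncomputable section

namespace GradualChange

/-! ## The Skorokhod space of càdlàg paths on the unit interval -/

/-- The space `D[0,1]` of right-continuous paths with left limits, with values in `H`. -/
structure CadlagPath (H : Type*) [NormedAddCommGroup H] where
  toFun : unitInterval → H
  rightCts : ∀ t, ContinuousWithinAt toFun (Ici t) t
  leftLim : ∀ t, ∃ l, Tendsto toFun (𝓝[<] t) (𝓝 l)

namespace CadlagPath

variable {H : Type*} [NormedAddCommGroup H]

instance : CoeFun (CadlagPath H) (fun _ => unitInterval → H) := ⟨CadlagPath.toFun⟩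

/-- The size of a time change `τ` together with the distance from `x` to the time-changed `y`. -/
def timeChangeCost (x y : CadlagPath H) (τ : unitInterval ≃o unitInterval) : ℝ≥0∞ :=
  max (⨆ t, edist (τ t) t) (⨆ t, edist (x t) (y (τ t)))

/-- The Skorokhod distance: the infimum, over all increasing bijections `τ` of `[0,1]`, of
`max (sup |τ t - t|) (sup ‖x t - y (τ t)‖)`. -/
instance : EDist (CadlagPath H) := ⟨fun x y => ⨅ τ : unitInterval ≃o unitInterval, timeChangeCost x y τ⟩

lemma edist_def (x y : CadlagPath H) : edist x y = ⨅ τ : unitInterval ≃o unitInterval, timeChangeCost x y τ := rfl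

lemma timeChangeCost_symm (x y : CadlagPath H) (τ : unitInterval ≃o unitInterval) :
    timeChangeCost y x τ.symm = timeChangeCost x y τ := by
  unfold timeChangeCost
  congr 1
  · rw [← τ.toEquiv.iSup_comp]
    refine iSup_congr fun t => ?_
    simp [edist_comm]
  · rw [← τ.toEquiv.iSup_comp]
    refine iSup_congr fun t => ?_
    simp [edist_comm]

lemma timeChangeCost_trans (x y z : CadlagPath H) (κ τ : unitInterval ≃o unitInterval) :
    timeChangeCost x z (κ.trans τ) ≤ timeChangeCost x y κ + timeChangeCost y z τ := by
  unfold timeChangeCost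
  refine max_le (iSup_le fun t => ?_) (iSup_le fun t => ?_)
  · calc edist ((κ.trans τ) t) t ≤ edist (τ (κ t)) (κ t) + edist (κ t) t := edist_triangle _ _ _
      _ ≤ (⨆ t, edist (τ t) t) + ⨆ t, edist (κ t) t :=
          add_le_add (le_iSup (fun s => edist (τ s) s) (κ t)) (le_iSup (fun s => edist (κ s) s) t)
      _ ≤ _ := by
          rw [add_comm]
          exact add_le_add (le_max_left _ _) (le_max_left _ _)
  · calc edist (x t) (z ((κ.trans τ) t))
        ≤ edist (x t) (y (κ t)) + edist (y (κ t)) (z (τ (κ t))) := edist_triangle _ _ _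
      _ ≤ (⨆ t, edist (x t) (y (κ t))) + ⨆ t, edist (y t) (z (τ t)) :=
          add_le_add (le_iSup (fun s => edist (x s) (y (κ s))) t)
            (le_iSup (fun s => edist (y s) (z (τ s))) (κ t))
      _ ≤ _ := add_le_add (le_max_right _ _) (le_max_right _ _)

/-- The Skorokhod topology is the one generated by the Skorokhod distance. -/
instance : PseudoEMetricSpace (CadlagPath H) where
  edist_self x := by
    refine le_antisymm ((iInf_le _ (OrderIso.refl unitInterval)).trans ?_) zero_le
    simp [timeChangeCost]
  edist_comm x y := by
    rw [edist_def, edist_def, ← (OrderIso.symm_bijective (α := unitInterval) (β := unitInterval)).surjective.iInf_comp (timeChangeCost x y)]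
    exact iInf_congr fun τ => timeChangeCost_symm y x τ
  edist_triangle x y z := by
    simp only [edist_def]
    exact ENNReal.le_iInf_add_iInf fun κ τ =>
      (iInf_le _ (κ.trans τ)).trans (timeChangeCost_trans x y z κ τ)

instance : MeasurableSpace (CadlagPath H) := borel _

instance : BorelSpace (CadlagPath H) := ⟨rfl⟩

/-- The step path `t ↦ s ⌊n t⌋`. -/
def ofSteps (n : ℕ) (s : ℕ → H) : CadlagPath H where
  toFun t := s ⌊(n : ℝ) * t⌋₊
  rightCts t := by
    have h1 : Tendsto (fun u : unitInterval => (n : ℝ) * u) (𝓝[≥] t) (𝓝[≥] ((n : ℝ) * t)) := by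
      refine tendsto_nhdsWithin_iff.2 ⟨?_, ?_⟩
      · exact (Continuous.tendsto (by fun_prop) t).mono_left nhdsWithin_le_nhds
      · filter_upwards [self_mem_nhdsWithin] with u hu
        exact mul_le_mul_of_nonneg_left (show (t : ℝ) ≤ u from hu) n.cast_nonneg
    have h2 := (tendsto_floor_right_pure_floor ((n : ℝ) * t)).comp h1
    refine tendsto_nhds_of_eventually_eq ?_
    filter_upwards [tendsto_pure.1 h2] with u hu
    simp only [Function.comp] at hu
    rw [← Int.floor_toNat, ← Int.floor_toNat, hu]
  leftLim t := by
    rcases Nat.eq_zero_or_pos n with rfl | hn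
    · exact ⟨s 0, by simpa using tendsto_const_nhds⟩
    have h1 : Tendsto (fun u : unitInterval => (n : ℝ) * u) (𝓝[<] t) (𝓝[<] ((n : ℝ) * t)) := by
      refine tendsto_nhdsWithin_iff.2 ⟨?_, ?_⟩
      · exact (Continuous.tendsto (by fun_prop) t).mono_left nhdsWithin_le_nhds
      · filter_upwards [self_mem_nhdsWithin] with u hu
        exact mul_lt_mul_of_pos_left (show (u : ℝ) < t from hu) (Nat.cast_pos.2 hn)
    have h2 := (tendsto_floor_left_pure_ceil_sub_one ((n : ℝ) * t)).comp h1
    refine ⟨s (⌈(n : ℝ) * t⌉ - 1).toNat, tendsto_nhds_of_eventually_eq ?_⟩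
    filter_upwards [tendsto_pure.1 h2] with u hu
    simp only [Function.comp] at hu
    rw [← Int.floor_toNat, hu]

end CadlagPath

/-! ## The error process -/

section Errors

variable {H : Type*} [NormedAddCommGroup H] [InnerProductSpace ℝ H]
  {Ω : Type*} [MeasurableSpace Ω]

/-- The lag-`r` covariance operator `C_r = E[ε₀ ⊗ ε_r]`, where `(v ⊗ w) x = ⟪v, x⟫ w`. -/
def lagCov (ε : ℤ → Ω → H) (P : Measure Ω) (r : ℤ) : H →L[ℝ] H :=
  ∫ ω, InnerProductSpace.rankOne ℝ (ε r ω) (ε 0 ω) ∂P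

/-- The long-run covariance operator `C_ε = ∑_{r ∈ ℤ} C_r`. -/
def longRunCov (ε : ℤ → Ω → H) (P : Measure Ω) : H →L[ℝ] H :=
  ∑' r : ℤ, lagCov ε P r

/-- A centered, strictly stationary sequence with a moment of order `k > 2`, norm-summable lagged
covariance operators and a nonzero long-run covariance operator, for which, along some orthonormal
basis of eigenvectors of the long-run covariance operator, the autocovariances of all scores are
jointly absolutely summable. The basis is indexed by a set of natural numbers (all of `ℕ`, up to
relabelling, if `H` is infinite-dimensional). -/
structure IsWeaklyDependentNoise [MeasurableSpace H] (ε : ℤ → Ω → H) (P : Measure Ω) : Prop where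
  measurable : ∀ i, Measurable (ε i)
  stationary : ∀ m : ℤ, P.map (fun ω i => ε (i + m) ω) = P.map (fun ω i => ε i ω)
  moment : ∃ k : ℝ, 2 < k ∧ Integrable (fun ω => ‖ε 1 ω‖ ^ k) P
  centered : ∀ i, ∫ ω, ε i ω ∂P = 0
  summable_lagCov : Summable fun r : ℤ => ‖lagCov ε P r‖
  longRunCov_ne_zero : longRunCov ε P ≠ 0
  spectral : ∃ (s : Set ℕ) (v : HilbertBasis s ℝ H) (ev : s → ℝ),
    (∀ p, longRunCov ε P (v p) = ev p • v p) ∧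
    Summable fun q : s × ℤ =>
      |cov[fun ω => ⟪ε 0 ω, v q.1⟫_ℝ, fun ω => ⟪ε q.2 ω, v q.1⟫_ℝ; P]|

/-- `W` is an `H`-valued Brownian motion on `[0,1]` with covariance operator `C`: it starts at `0`,
has continuous paths and independent increments, and `W t - W s` is a centered Gaussian element
of `H` with covariance operator `(t - s) C`. -/
structure IsBrownianMotion {Ω' : Type*} [MeasurableSpace Ω'] [MeasurableSpace H]
    (W : Ω' → CadlagPath H) (C : H →L[ℝ] H) (P' : Measure Ω') : Prop where
  aemeasurable : ∀ t, AEMeasurable (fun ω => W ω t) P'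
  start : ∀ᵐ ω ∂P', W ω 0 = 0
  continuous : ∀ᵐ ω ∂P', Continuous (W ω)
  indep : HasIndepIncrements (fun t ω => W ω t) P'
  gaussian : ∀ s t : unitInterval, s ≤ t → ∀ x : H,
    P'.map (fun ω => ⟪W ω t - W ω s, x⟫_ℝ) =
      gaussianReal 0 (Real.toNNReal (((t : ℝ) - s) * ⟪C x, x⟫_ℝ))

/-- The partial sum process `t ↦ n^{-1/2} ∑_{i=1}^{⌊nt⌋} ε_i`. -/
def partialSumProcess (ε : ℤ → Ω → H) (n : ℕ) (ω : Ω) : CadlagPath H :=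
  CadlagPath.ofSteps n fun m => (√(n : ℝ))⁻¹ • ∑ i ∈ Finset.Icc 1 m, ε (i : ℤ) ω

end Errors

/-! ## Change function and weight function -/

/-- A non-constant, bounded function on `[0,1]` with `g 0 = 0` which is piecewise continuous:
`[0,1]` is a disjoint union of finitely many intervals of positive length on each of which `g` is
continuous. (Riemann integrability follows, as `g` is bounded with finitely many
discontinuities.) -/
structure IsChangeFunction (g : ℝ → ℝ) : Prop where
  nonconst : ∃ x ∈ Icc (0 : ℝ) 1, ∃ y ∈ Icc (0 : ℝ) 1, g x ≠ g y
  bounded : ∃ M, ∀ x ∈ Icc (0 : ℝ) 1, |g x| ≤ M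
  piecewise : ∃ (m : ℕ) (J : Fin m → Set ℝ),
    (∀ j, (J j).OrdConnected ∧ (J j).Nontrivial ∧ ContinuousOn g (J j)) ∧
    Pairwise (fun i j => Disjoint (J i) (J j)) ∧ ⋃ j, J j = Icc 0 1
  map_zero : g 0 = 0

/-- A non-constant function of bounded variation on `[-1,1]` which vanishes on `[-1,0]` and is
Hölder continuous on `[0,1]`. -/
structure IsWeightFunction (h : ℝ → ℝ) : Prop where
  nonconst : ∃ x ∈ Icc (-1 : ℝ) 1, ∃ y ∈ Icc (-1 : ℝ) 1, h x ≠ h y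
  zero_of_nonpos : ∀ x ∈ Icc (-1 : ℝ) 0, h x = 0
  boundedVariation : BoundedVariationOn h (Icc (-1) 1)
  holder : ∃ α > (0 : ℝ), ∃ β > (0 : ℝ), ∀ s ∈ Icc (0 : ℝ) 1, ∀ t ∈ Icc (0 : ℝ) 1,
    |h t - h s| ≤ β * |s - t| ^ α

/-- The signal strength
`sup_{0 ≤ t ≤ 1} |∫₀¹ h(x - t) g(x) dx - ∫₀¹ g(x) dx ∫₀¹ h(x - t) dx|`. -/
def signal (h g : ℝ → ℝ) : ℝ :=
  ⨆ t : Icc (0 : ℝ) 1, |(∫ x in (0 : ℝ)..1, h (x - t) * g x) -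
    (∫ x in (0 : ℝ)..1, g x) * ∫ x in (0 : ℝ)..1, h (x - t)|

/-! ## Test statistics -/

section Statistics

variable {H : Type*} [NormedAddCommGroup H] [InnerProductSpace ℝ H]

/-- The sample mean of `x 1, …, x n`. -/
def sampleMean (n : ℕ) (x : ℕ → H) : H := (n : ℝ)⁻¹ • ∑ i ∈ Finset.Icc 1 n, x i

/-- `n^{-1/2} ∑_{i=1}^n h((i - k)/n) (x i - x̄_n)`. -/
def weightedSum (h : ℝ → ℝ) (n : ℕ) (x : ℕ → H) (k : ℕ) : H :=
  (√(n : ℝ))⁻¹ • ∑ i ∈ Finset.Icc 1 n, h (((i : ℝ) - k) / n) • (x i - sampleMean n x)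

/-- The fully functional statistic, a maximum over `1 ≤ k < n` (it is `0` for `n ≤ 1`). -/
def statFF (h : ℝ → ℝ) (n : ℕ) (x : ℕ → H) : ℝ :=
  ⨆ k : Finset.Ico 1 n, ‖weightedSum h n x k‖

/-- The set of eigenvalues of a bounded operator. -/
def eigenvalues (C : H →L[ℝ] H) : Set ℝ := {l | Module.End.HasEigenvalue (C : H →ₗ[ℝ] H) l}

/-- The largest eigenvalue (meaningful if there is one). -/
def topEigenvalue (C : H →L[ℝ] H) : ℝ := sSup (eigenvalues C)

/-- The regularized operator `C + λ₁ Id`, with `λ₁` the largest eigenvalue of `C`. -/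
def regularized (C : H →L[ℝ] H) : H →L[ℝ] H :=
  C + topEigenvalue C • ContinuousLinearMap.id ℝ H

open Classical in
/-- `A^{-1/2}`: the positive operator `B` with `B A B = Id`. It exists and is unique when `A` is
positive with bounded inverse; the value `0` in other cases is a placeholder. -/
def invSqrt [CompleteSpace H] (A : H →L[ℝ] H) : H →L[ℝ] H :=
  if hA : ∃ B : H →L[ℝ] H, B.IsPositive ∧ B ∘L A ∘L B = ContinuousLinearMap.id ℝ H
  then hA.choose else 0

/-- The conditions under which the weight `(C + λ₁ Id)^{-1/2}` is meaningful: `C` is self-adjoint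
with a largest eigenvalue `λ₁`, and `C + λ₁ Id` is positive with bounded inverse. Every nonzero
compact positive operator is of this kind. -/
structure IsAdmissible [CompleteSpace H] (C : H →L[ℝ] H) : Prop where
  selfAdjoint : IsSelfAdjoint C
  exists_top : ∃ l, IsGreatest (eigenvalues C) l
  positive : (regularized C).IsPositive
  invertible : IsUnit (regularized C)

/-- The weighted functional statistic, a maximum over `1 ≤ k < n`. -/
def statWF [CompleteSpace H] (h : ℝ → ℝ) (C : H →L[ℝ] H) (n : ℕ) (x : ℕ → H) : ℝ :=
  ⨆ k : Finset.Ico 1 n, ‖invSqrt (regularized C) (weightedSum h n x k)‖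

end Statistics

/-! ## Stochastic orders -/

section Orders

variable {Ω : Type*} [MeasurableSpace Ω]

/-- `T n → ∞` in probability. -/
def TendstoInProbAtTop (T : ℕ → Ω → ℝ) (P : Measure Ω) : Prop :=
  ∀ M : ℝ, Tendsto (fun n => P {ω | T n ω ≤ M}) atTop (𝓝 0)

/-- `Y n = o_P(a n)`. -/
def IsLittleOInProb (Y : ℕ → Ω → ℝ) (a : ℕ → ℝ) (P : Measure Ω) : Prop :=
  ∀ δ > 0, Tendsto (fun n => P {ω | δ * |a n| < |Y n ω|}) atTop (𝓝 0)

end Orders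

end GradualChange

end

open GradualChange

/-!
For a single index `k`, the weighted sum of the observations is

  `√n * signalCoeff h g n k • Δ n + (weighted sum of the errors)`,

and both statistics dominate the corresponding norm at any one index. It therefore suffices to
follow the statistics along one sequence of indices `k n` with `k n / n → t`, where `t` is a point
at which the supremum in `signal h g` is not zero.

* Signal. `h` is continuous on `[-1,1]` (it vanishes at `0`) and `g` is bounded and continuous off
  finitely many points, so Riemann sums converge by dominated convergence
  (`tendsto_riemannSum`), and `signalCoeff h g n (k n)` converges to the nonzero quantity inside the
  absolute value in `signal h g` (`exists_signalCoeff_lower_bound`). The signal has norm at least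
  a multiple of `√n ‖Δ n‖`.
* Noise. After centering the weights, the noise is `n^{-1/2}` times a sum of errors with uniformly
  bounded weights. Expanding in the basis of `IsWeaklyDependentNoise.spectral` and using
  stationarity, its second moment is bounded by a constant times the sum of the absolute
  autocovariances of all scores (`IsWeaklyDependentNoise.exists_lintegral_le`). As only one index
  per `n` matters, Chebyshev's inequality shows that the noise is bounded in probability.
* Weight. For a positive invertible operator `A` on a real Hilbert space, `A^{-1/2}` exists, by the
  binomial series of `(1 - T)^{-1/2}` with `T = 1 - A / ‖A‖` (`exists_invSqrt`). With
  `B = A^{-1/2}`, the identity `⟪A (B v), B v⟫ = ‖v‖²` gives `‖v‖² ≤ ‖A‖ ‖B v‖²`. For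
  `A = C + λ₁ Id` one has `‖A‖ ≤ 2 ‖C‖ = o_P(n ‖Δ n‖²)`, so `‖B v‖` diverges if `‖v‖` is at least
  of order `√n ‖Δ n‖`.
-/

namespace GradualChange

/-! ### Inverse square roots of positive operators on a real Hilbert space -/

section Operators

variable {H : Type*} [NormedAddCommGroup H] [InnerProductSpace ℝ H]

/-- The coefficients of the power series of `(1 - x)^{-1/2}` are nonnegative. -/
lemma multichoose_half_nonneg (n : ℕ) : 0 ≤ Ring.multichoose (1 / 2 : ℝ) n := by
  have h1 := Ring.factorial_nsmul_multichoose_eq_ascPochhammer (1 / 2 : ℝ) n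
  rw [Polynomial.ascPochhammer_smeval_eq_eval, nsmul_eq_mul] at h1
  have h2 : 0 < (ascPochhammer ℝ n).eval (1 / 2) := ascPochhammer_pos n _ (by norm_num)
  have h3 : (0 : ℝ) < n.factorial := by positivity
  by_contra! h4
  nlinarith

/-- The power series of `(1 - x)^{-1/2}` squares to the geometric series. -/
lemma sum_antidiagonal_multichoose_half (n : ℕ) :
    ∑ p ∈ Finset.HasAntidiagonal.antidiagonal n,
      Ring.multichoose (1 / 2 : ℝ) p.1 * Ring.multichoose (1 / 2 : ℝ) p.2 = 1 := by
  have h1 := Ring.add_choose_eq (r := -(1 / 2 : ℝ)) (s := -(1 / 2 : ℝ)) n (Commute.all _ _)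
  rw [show -(1 / 2 : ℝ) + -(1 / 2 : ℝ) = -1 by norm_num, Ring.choose_neg', Ring.multichoose_one]
    at h1
  have h2 : ∀ p ∈ Finset.HasAntidiagonal.antidiagonal n,
      Ring.choose (-(1 / 2 : ℝ)) p.1 * Ring.choose (-(1 / 2 : ℝ)) p.2 =
        Int.negOnePow n •
          (Ring.multichoose (1 / 2 : ℝ) p.1 * Ring.multichoose (1 / 2 : ℝ) p.2) := by
    intro p hp
    rw [Ring.choose_neg', Ring.choose_neg', smul_mul_smul_comm,
      ← Finset.HasAntidiagonal.mem_antidiagonal.1 hp, Nat.cast_add, Int.negOnePow_add]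
  rw [Finset.sum_congr rfl h2, ← Finset.smul_sum] at h1
  exact (smul_left_cancel _ h1).symm

lemma multichoose_half_le_one (n : ℕ) : Ring.multichoose (1 / 2 : ℝ) n ≤ 1 := by
  have h1 := Finset.single_le_sum
    (f := fun p : ℕ × ℕ => Ring.multichoose (1 / 2 : ℝ) p.1 * Ring.multichoose (1 / 2 : ℝ) p.2)
    (fun p _ => mul_nonneg (multichoose_half_nonneg p.1) (multichoose_half_nonneg p.2))
    (show (0, n) ∈ Finset.HasAntidiagonal.antidiagonal n by simp)
  rw [sum_antidiagonal_multichoose_half] at h1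
  simpa using h1

/-- The Cauchy–Schwarz inequality for the semi-inner product `(x, y) ↦ ⟪T x, y⟫` at `y = T x`. -/
lemma norm_apply_sq_le_of_isPositive {T : H →L[ℝ] H} (hT : T.IsPositive) (x : H) :
    ‖T x‖ ^ 2 ≤ ‖T‖ * ⟪T x, x⟫_ℝ := by
  let b : LinearMap.BilinForm ℝ H := (innerₗ H).comp (T : H →ₗ[ℝ] H)
  have hb : ∀ x y, b x y = ⟪T x, y⟫_ℝ := fun x y => rfl
  have h1 := b.apply_sq_le_of_symm (fun y => hT.inner_nonneg_left y)
    ⟨fun y z => by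
      simp only [hb, RingHom.id_apply]
      rw [hT.inner_left_eq_inner_right, real_inner_comm]⟩ x (T x)
  simp only [hb, real_inner_self_eq_norm_sq] at h1
  have h2 : ⟪T (T x), T x⟫_ℝ ≤ ‖T‖ * ‖T x‖ ^ 2 := by
    refine (real_inner_le_norm _ _).trans ?_
    rw [sq, ← mul_assoc]
    exact mul_le_mul_of_nonneg_right (T.le_opNorm _) (norm_nonneg _)
  have h3 := hT.inner_nonneg_left x
  rcases eq_or_lt_of_le (sq_nonneg ‖T x‖) with h0 | h0
  · rw [← h0]
    positivity
  · refine le_of_mul_le_mul_right ?_ h0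
    nlinarith [mul_le_mul_of_nonneg_left h2 h3]

lemma norm_le_of_isPositive_of_inner_le {T : H →L[ℝ] H} (hT : T.IsPositive) {q : ℝ} (hq : 0 ≤ q)
    (h : ∀ x, ⟪T x, x⟫_ℝ ≤ q * ‖x‖ ^ 2) : ‖T‖ ≤ q := by
  rcases eq_or_lt_of_le (norm_nonneg T) with h0 | h0
  · rwa [← h0]
  have h1 : ‖T‖ ≤ √(‖T‖ * q) := by
    refine T.opNorm_le_bound (Real.sqrt_nonneg _) fun x => ?_
    refine abs_le_of_sq_le_sq' ?_ (by positivity) |>.2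
    rw [mul_pow, Real.sq_sqrt (by positivity), mul_assoc]
    exact (norm_apply_sq_le_of_isPositive hT x).trans
      (mul_le_mul_of_nonneg_left (h x) (norm_nonneg _))
  have h2 := (Real.le_sqrt' h0).1 h1
  nlinarith

lemma isPositive_of_hasSum {ι : Type*} {f : ι → H →L[ℝ] H} {S : H →L[ℝ] H} (hf : HasSum f S)
    (hpos : ∀ i, (f i).IsPositive) : S.IsPositive := by
  have h1 : ∀ x y, HasSum (fun i => ⟪f i x, y⟫_ℝ) ⟪S x, y⟫_ℝ := fun x y =>
    (hf.mapL (ContinuousLinearMap.apply ℝ H x)).mapL ((innerSL ℝ).flip y)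
  refine (ContinuousLinearMap.isPositive_iff S).2 ⟨fun x y => ?_, fun x => ?_⟩
  · have h2 := h1 y x
    have h3 := h1 x y
    simp only [fun i => (hpos i).inner_left_eq_inner_right y x,
      fun i => real_inner_comm (f i x) y] at h2
    rw [ContinuousLinearMap.coe_coe, h3.unique h2, real_inner_comm]
  · exact (h1 x x).nonneg fun i => (hpos i).inner_nonneg_left x

variable [CompleteSpace H]

lemma isPositive_pow {T : H →L[ℝ] H} (hT : T.IsPositive) (n : ℕ) : (T ^ n).IsPositive := by
  induction n using Nat.twoStepInduction with
  | zero => simp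
  | one => simpa using hT
  | more n ih _ =>
    have h1 := ih.conj_adjoint T
    rw [hT.isSelfAdjoint.adjoint_eq] at h1
    rwa [pow_succ, pow_succ']

/-- If `T` is positive with `‖T‖ < 1`, the binomial series of `(1 - T)^{-1/2}` converges to a
positive operator `B` with `B (1 - T) B = 1`. -/
lemma exists_invSqrt_one_sub {T : H →L[ℝ] H} (hT : T.IsPositive) (hT1 : ‖T‖ < 1) :
    ∃ B : H →L[ℝ] H, B.IsPositive ∧ B * (1 - T) * B = 1 := by
  let c : ℕ → ℝ := fun n => Ring.multichoose (1 / 2 : ℝ) n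
  have hs : Summable fun n => ‖c n • T ^ n‖ := by
    refine Summable.of_nonneg_of_le (fun _ => norm_nonneg _) (fun n => ?_)
      (summable_norm_geometric_of_norm_lt_one hT1)
    rw [norm_smul, Real.norm_of_nonneg (multichoose_half_nonneg n)]
    exact mul_le_of_le_one_left (norm_nonneg _) (multichoose_half_le_one n)
  set B : H →L[ℝ] H := ∑' n, c n • T ^ n with hB
  have hBB : B * B = ∑' n, T ^ n := by
    rw [hB, tsum_mul_tsum_eq_tsum_sum_antidiagonal_of_summable_norm hs hs]
    refine tsum_congr fun n => ?_
    calc ∑ kl ∈ Finset.HasAntidiagonal.antidiagonal n, c kl.1 • T ^ kl.1 * c kl.2 • T ^ kl.2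
        = ∑ kl ∈ Finset.HasAntidiagonal.antidiagonal n, (c kl.1 * c kl.2) • T ^ n := by
          refine Finset.sum_congr rfl fun kl hkl => ?_
          rw [smul_mul_smul_comm, ← pow_add, Finset.HasAntidiagonal.mem_antidiagonal.1 hkl]
      _ = T ^ n := by
          rw [← Finset.sum_smul, sum_antidiagonal_multichoose_half, one_smul]
  have h1 : B * (B * (1 - T)) = 1 := by
    rw [← mul_assoc, hBB, geom_series_mul_neg T hT1]
  have h2 : (1 - T) * B * B = 1 := by
    rw [mul_assoc, hBB, mul_neg_geom_series T hT1]
  refine ⟨B, isPositive_of_hasSum hs.of_norm.hasSum fun n => ?_, ?_⟩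
  · exact (isPositive_pow hT n).smul_of_nonneg (multichoose_half_nonneg n)
  · rw [mul_assoc, left_inv_eq_right_inv h2 h1, h1]

/-- A positive invertible operator `A` has an inverse square root: after division by `‖A‖` it is
`1 - T` with `T` positive and `‖T‖ < 1`. -/
lemma exists_invSqrt {A : H →L[ℝ] H} (hA : A.IsPositive) (hu : IsUnit A) :
    ∃ B : H →L[ℝ] H, B.IsPositive ∧ B ∘L A ∘L B = ContinuousLinearMap.id ℝ H := by
  rcases subsingleton_or_nontrivial H with hH | hH
  · exact ⟨0, ContinuousLinearMap.isPositive_zero, Subsingleton.elim _ _⟩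
  obtain ⟨u, hu⟩ := hu
  let R : H →L[ℝ] H := u⁻¹.val
  have hRA : ∀ x, R (A x) = x := fun x => by
    rw [← mul_apply_eq_comp, ← hu, Units.inv_mul, one_apply_eq_self]
  have hA0 : 0 < ‖A‖ := norm_pos_iff.2 (hu ▸ u.ne_zero)
  have hR0 : 0 < ‖R‖ := norm_pos_iff.2 u⁻¹.ne_zero
  have hlow : ∀ x, (‖R‖ ^ 2 * ‖A‖ ^ 2)⁻¹ * ‖x‖ ^ 2 ≤ ‖A‖⁻¹ * ⟪A x, x⟫_ℝ := by
    intro x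
    have h1 : ‖x‖ ≤ ‖R‖ * ‖A x‖ := by simpa [hRA] using R.le_opNorm (A x)
    have h2 : ‖x‖ ^ 2 ≤ ‖R‖ ^ 2 * (‖A‖ * ⟪A x, x⟫_ℝ) := by
      calc ‖x‖ ^ 2 ≤ (‖R‖ * ‖A x‖) ^ 2 := by gcongr
        _ = ‖R‖ ^ 2 * ‖A x‖ ^ 2 := mul_pow _ _ _
        _ ≤ _ := by
          gcongr
          exact norm_apply_sq_le_of_isPositive hA x
    calc (‖R‖ ^ 2 * ‖A‖ ^ 2)⁻¹ * ‖x‖ ^ 2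
        ≤ (‖R‖ ^ 2 * ‖A‖ ^ 2)⁻¹ * (‖R‖ ^ 2 * (‖A‖ * ⟪A x, x⟫_ℝ)) := by gcongr
      _ = _ := by field_simp
  let T : H →L[ℝ] H := 1 - ‖A‖⁻¹ • A
  have hTin : ∀ x, ⟪T x, x⟫_ℝ = ‖x‖ ^ 2 - ‖A‖⁻¹ * ⟪A x, x⟫_ℝ := fun x => by
    simp [T, inner_sub_left, inner_smul_left]
  have hT : T.IsPositive := by
    refine (ContinuousLinearMap.isPositive_iff T).2 ⟨?_, fun x => ?_⟩
    · exact (ContinuousLinearMap.isPositive_one (𝕜 := ℝ) (E := H)).isSymmetric.sub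
        (hA.smul_of_nonneg (inv_nonneg.2 hA0.le)).isSymmetric
    · rw [hTin, sub_nonneg, inv_mul_le_iff₀ hA0]
      refine (real_inner_le_norm _ _).trans ?_
      rw [sq, ← mul_assoc]
      exact mul_le_mul_of_nonneg_right (A.le_opNorm _) (norm_nonneg _)
  have hq0 : 0 ≤ 1 - (‖R‖ ^ 2 * ‖A‖ ^ 2)⁻¹ := by
    obtain ⟨x, hx⟩ := exists_ne (0 : H)
    have h3 := hT.inner_nonneg_left x
    rw [hTin] at h3
    have h4 := hlow x
    have h5 : 0 < ‖x‖ ^ 2 := by positivity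
    by_contra! h6
    nlinarith
  have hT1 : ‖T‖ < 1 := by
    refine (norm_le_of_isPositive_of_inner_le hT hq0 fun x => ?_).trans_lt
      (sub_lt_self _ (by positivity))
    rw [hTin]
    linarith [hlow x]
  obtain ⟨B, hB, hB1⟩ := exists_invSqrt_one_sub hT hT1
  refine ⟨(√‖A‖)⁻¹ • B, hB.smul_of_nonneg (by positivity), ?_⟩
  have h7 : A = ‖A‖ • (1 - T) := by simp [T, smul_smul, hA0.ne']
  change (√‖A‖)⁻¹ • B * (A * (√‖A‖)⁻¹ • B) = 1
  have h8 : (√‖A‖)⁻¹ * (‖A‖ * (√‖A‖)⁻¹) = 1 := by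
    have h9 : √‖A‖ ≠ 0 := (Real.sqrt_pos.2 hA0).ne'
    field_simp
    exact (Real.sq_sqrt hA0.le).symm
  calc (√‖A‖)⁻¹ • B * (A * (√‖A‖)⁻¹ • B)
      = (√‖A‖)⁻¹ • B * ((‖A‖ • (1 - T)) * (√‖A‖)⁻¹ • B) := by rw [← h7]
    _ = ((√‖A‖)⁻¹ * (‖A‖ * (√‖A‖)⁻¹)) • (B * (1 - T) * B) := by
      simp only [smul_mul_smul_comm, mul_assoc]
    _ = 1 := by rw [h8, hB1, one_smul]

/-- Since `⟪A (B v), B v⟫ = ‖v‖²` for `B = A^{-1/2}`, this weight shrinks norms at most by the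
factor `‖A‖^{-1/2}`. -/
lemma norm_sq_le_opNorm_mul_norm_invSqrt_sq {A : H →L[ℝ] H} (hA : A.IsPositive) (hu : IsUnit A)
    (v : H) : ‖v‖ ^ 2 ≤ ‖A‖ * ‖invSqrt A v‖ ^ 2 := by
  have hex := exists_invSqrt hA hu
  have hB : invSqrt A = hex.choose := dif_pos hex
  obtain ⟨hpos, hid⟩ := hex.choose_spec
  rw [← hB] at hpos hid
  have h1 : invSqrt A (A (invSqrt A v)) = v := by
    simpa using congrArg (fun f : H →L[ℝ] H => f v) hid
  calc ‖v‖ ^ 2 = ⟪invSqrt A (A (invSqrt A v)), v⟫_ℝ := by rw [h1, real_inner_self_eq_norm_sq]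
    _ = ⟪A (invSqrt A v), invSqrt A v⟫_ℝ := hpos.inner_left_eq_inner_right _ _
    _ ≤ ‖A (invSqrt A v)‖ * ‖invSqrt A v‖ := real_inner_le_norm _ _
    _ ≤ ‖A‖ * ‖invSqrt A v‖ * ‖invSqrt A v‖ := by gcongr; exact A.le_opNorm _
    _ = _ := by ring

lemma norm_regularized_le {C : H →L[ℝ] H} (hC : IsAdmissible C) : ‖regularized C‖ ≤ 2 * ‖C‖ := by
  obtain ⟨l, hl⟩ := hC.exists_top
  have h1 : topEigenvalue C = l := hl.csSup_eq
  obtain ⟨x, hx⟩ := Module.End.HasEigenvalue.exists_hasEigenvector hl.1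
  have h2 : C x = l • x := hx.apply_eq_smul
  have h3 : 0 < ‖x‖ := norm_pos_iff.2 hx.2
  have h4 : ‖l‖ ≤ ‖C‖ := by
    have h5 := C.le_opNorm x
    rw [h2, norm_smul] at h5
    exact le_of_mul_le_mul_right h5 h3
  calc ‖regularized C‖ ≤ ‖C‖ + ‖topEigenvalue C • ContinuousLinearMap.id ℝ H‖ := norm_add_le _ _
    _ ≤ ‖C‖ + ‖l‖ * 1 := by
      rw [h1, norm_smul]
      gcongr
      exact ContinuousLinearMap.norm_id_le
    _ ≤ 2 * ‖C‖ := by linarith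

end Operators

/-! ### Riemann sums -/

section RiemannSums

lemma ceil_mem_Icc {n : ℕ} (hn : 0 < n) {x : ℝ} (hx : x ∈ Ioc (0 : ℝ) 1) :
    ⌈(n : ℝ) * x⌉₊ ∈ Finset.Icc 1 n := by
  have hn' : (0 : ℝ) < n := Nat.cast_pos.2 hn
  refine Finset.mem_Icc.2 ⟨Nat.one_le_iff_ne_zero.2 (Nat.ceil_pos.2 (mul_pos hn' hx.1)).ne', ?_⟩
  exact Nat.ceil_le.2 (mul_le_of_le_one_right hn'.le hx.2)

/-- A Riemann sum is the integral of the step function `x ↦ φ ⌈n x⌉`. -/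
lemma integral_ceil_eq_sum {n : ℕ} (hn : 0 < n) (φ : ℕ → ℝ) :
    ∫ x in (0 : ℝ)..1, φ ⌈(n : ℝ) * x⌉₊ = (n : ℝ)⁻¹ * ∑ i ∈ Finset.Icc 1 n, φ i := by
  have hn' : (0 : ℝ) < n := Nat.cast_pos.2 hn
  have hcongr : ∀ k : ℕ, EqOn (fun _ => φ (k + 1)) (fun x : ℝ => φ ⌈(n : ℝ) * x⌉₊)
      (Ioc ((k : ℝ) / n) (((k + 1 : ℕ) : ℝ) / n)) := by
    intro k x hx
    have h1 : ⌈(n : ℝ) * x⌉₊ = k + 1 := by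
      rw [Nat.ceil_eq_iff (by simp)]
      refine ⟨?_, ?_⟩
      · simpa [mul_comm] using (div_lt_iff₀ hn').1 hx.1
      · simpa [mul_comm] using (le_div_iff₀ hn').1 hx.2
    simp only [h1]
  have hle : ∀ k : ℕ, (k : ℝ) / n ≤ ((k + 1 : ℕ) : ℝ) / n := fun k => by
    gcongr
    exact Nat.le_succ k
  have hint : ∀ k < n, IntervalIntegrable (fun x : ℝ => φ ⌈(n : ℝ) * x⌉₊) volume
      ((k : ℝ) / n) (((k + 1 : ℕ) : ℝ) / n) := by
    intro k _
    refine (intervalIntegrable_const (c := φ (k + 1))).congr ?_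
    rw [uIoc_of_le (hle k)]
    exact hcongr k
  have h2 := intervalIntegral.sum_integral_adjacent_intervals (a := fun k : ℕ => (k : ℝ) / n) hint
  simp only [Nat.cast_zero, zero_div, div_self hn'.ne'] at h2
  rw [← h2, Finset.mul_sum, Finset.range_eq_Ico, Finset.sum_Ico_eq_sum_range]
  rw [← Finset.Ico_add_one_right_eq_Icc, Finset.sum_Ico_eq_sum_range]
  simp only [Nat.sub_zero, Nat.add_sub_cancel, zero_add]
  refine Finset.sum_congr rfl fun k _ => ?_
  rw [intervalIntegral.integral_of_le (hle k),
    ← setIntegral_congr_fun measurableSet_Ioc (hcongr k), ← intervalIntegral.integral_of_le (hle k),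
    intervalIntegral.integral_const, smul_eq_mul, add_comm 1 k]
  congr 1
  push_cast
  field_simp
  ring

lemma tendsto_ceil_div {x : ℝ} (hx : x ∈ Ioc (0 : ℝ) 1) :
    Tendsto (fun n : ℕ => (⌈(n : ℝ) * x⌉₊ : ℝ) / n) atTop (𝓝 x) := by
  have h1 := (tendsto_nat_ceil_mul_div_atTop hx.1.le).comp
    (tendsto_natCast_atTop_atTop (R := ℝ))
  simpa [Function.comp_def, mul_comm] using h1

/-- Convergence of Riemann sums whose integrand may change with `n`: it suffices that the
integrands are uniformly bounded and converge almost everywhere along the nodes `⌈n x⌉ / n`. -/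
lemma tendsto_riemannSum {u : ℕ → ℝ → ℝ} {f : ℝ → ℝ} {M : ℝ}
    (hM : ∀ᶠ n in atTop, ∀ i ∈ Finset.Icc 1 n, |u n ((i : ℝ) / n)| ≤ M)
    (hlim : ∀ᵐ x : ℝ, x ∈ Ioc (0 : ℝ) 1 →
      Tendsto (fun n : ℕ => u n ((⌈(n : ℝ) * x⌉₊ : ℝ) / n)) atTop (𝓝 (f x))) :
    Tendsto (fun n : ℕ => (n : ℝ)⁻¹ * ∑ i ∈ Finset.Icc 1 n, u n ((i : ℝ) / n)) atTop
      (𝓝 (∫ x in (0 : ℝ)..1, f x)) := by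
  have h1 : Tendsto (fun n : ℕ => ∫ x in (0 : ℝ)..1, u n ((⌈(n : ℝ) * x⌉₊ : ℝ) / n)) atTop
      (𝓝 (∫ x in (0 : ℝ)..1, f x)) := by
    refine intervalIntegral.tendsto_integral_filter_of_dominated_convergence (fun _ => M) ?_ ?_
      intervalIntegrable_const ?_
    · refine Eventually.of_forall fun n => Measurable.aestronglyMeasurable ?_
      exact (measurable_from_nat (f := fun i : ℕ => u n ((i : ℝ) / n))).comp
        (Nat.measurable_ceil.comp (measurable_const_mul (n : ℝ)))
    · filter_upwards [hM, eventually_gt_atTop 0] with n hn hn0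
      refine Eventually.of_forall fun x hx => ?_
      rw [uIoc_of_le zero_le_one] at hx
      exact hn _ (ceil_mem_Icc hn0 hx)
    · simpa only [uIoc_of_le (zero_le_one (α := ℝ))] using hlim
  refine h1.congr' ?_
  filter_upwards [eventually_gt_atTop 0] with n hn
  exact integral_ceil_eq_sum hn fun i => u n ((i : ℝ) / n)

end RiemannSums

/-! ### The change function and the weight function -/

section Functions

variable {g h : ℝ → ℝ}

/-- A change function is continuous off the endpoints of its finitely many pieces. -/
lemma IsChangeFunction.ae_continuousAt (hg : IsChangeFunction g) :
    ∀ᵐ x : ℝ, x ∈ Ioc (0 : ℝ) 1 → ContinuousAt g x := by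
  obtain ⟨m, J, hJ, -, hU⟩ := hg.piecewise
  have h1 : ∀ᵐ x : ℝ, ∀ j, x ∉ frontier (J j) := by
    refine ae_all_iff.2 fun j => measure_eq_zero_iff_ae_notMem.1 ?_
    exact (hJ j).1.convex.addHaar_frontier volume
  filter_upwards [h1] with x hx hx01
  have h2 : x ∈ ⋃ j, J j := hU ▸ Ioc_subset_Icc_self hx01
  obtain ⟨j, hj⟩ := mem_iUnion.1 h2
  have h3 : x ∈ interior (J j) := by
    by_contra h4
    exact hx j ⟨subset_closure hj, h4⟩
  exact (hJ j).2.2.continuousAt (mem_interior_iff_mem_nhds.1 h3)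

/-- A weight function is continuous on all of `[-1,1]`, as it vanishes at `0`. -/
lemma IsWeightFunction.continuousOn (hh : IsWeightFunction h) : ContinuousOn h (Icc (-1) 1) := by
  obtain ⟨α, hα, β, hβ, hhol⟩ := hh.holder
  have h1 : ContinuousOn h (Icc (-1) 0) :=
    continuousOn_const.congr fun x hx => hh.zero_of_nonpos x hx
  have h2 : ContinuousOn h (Icc 0 1) := by
    intro s hs
    refine tendsto_iff_dist_tendsto_zero.2 ?_
    have h3 : Tendsto (fun t : ℝ => β * |s - t| ^ α) (𝓝[Icc 0 1] s) (𝓝 0) := by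
      have h4 : Continuous fun t : ℝ => β * |s - t| ^ α :=
        continuous_const.mul ((by fun_prop : Continuous fun t : ℝ => |s - t|).rpow_const
          fun _ => Or.inr hα.le)
      have h5 := (h4.tendsto s).mono_left (nhdsWithin_le_nhds (s := Icc (0 : ℝ) 1))
      simpa [Real.zero_rpow hα.ne'] using h5
    refine squeeze_zero' (Eventually.of_forall fun _ => dist_nonneg) ?_ h3
    filter_upwards [self_mem_nhdsWithin] with t ht
    rw [Real.dist_eq]
    exact hhol s hs t ht
  have h6 := h1.union_of_isClosed h2 isClosed_Icc isClosed_Icc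
  rwa [Icc_union_Icc_eq_Icc (by norm_num) (by norm_num)] at h6

lemma IsWeightFunction.exists_bound (hh : IsWeightFunction h) :
    ∃ M, 0 ≤ M ∧ ∀ x ∈ Icc (-1 : ℝ) 1, |h x| ≤ M := by
  obtain ⟨M, hM⟩ := isCompact_Icc.exists_bound_of_continuousOn hh.continuousOn
  exact ⟨M, (norm_nonneg _).trans (hM 0 (by norm_num)), hM⟩

/-- The index `⌊n t⌋`, moved into the range `1 ≤ k < n` over which the statistics maximize. -/
noncomputable def changeIndex (t : ℝ) (n : ℕ) : ℕ := max 1 (min ⌊(n : ℝ) * t⌋₊ (n - 1))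

lemma changeIndex_mem {t : ℝ} {n : ℕ} (hn : 2 ≤ n) : changeIndex t n ∈ Finset.Ico 1 n := by
  unfold changeIndex
  rw [Finset.mem_Ico]
  omega

lemma tendsto_changeIndex_div {t : ℝ} (ht : t ∈ Icc (0 : ℝ) 1) :
    Tendsto (fun n : ℕ => (changeIndex t n : ℝ) / n) atTop (𝓝 t) := by
  have h1 : Tendsto (fun n : ℕ => t - 1 / (n : ℝ)) atTop (𝓝 t) := by
    simpa using tendsto_const_nhds.sub (tendsto_one_div_atTop_nhds_zero_nat (𝕜 := ℝ))
  have h2 : Tendsto (fun n : ℕ => t + 1 / (n : ℝ)) atTop (𝓝 t) := by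
    simpa using tendsto_const_nhds.add (tendsto_one_div_atTop_nhds_zero_nat (𝕜 := ℝ))
  refine tendsto_of_tendsto_of_tendsto_of_le_of_le' h1 h2 ?_ ?_
  all_goals
    filter_upwards [eventually_ge_atTop 2] with n hn
    have hn' : (0 : ℝ) < n := by positivity
    have h3 : (n : ℝ) * t ≤ n := mul_le_of_le_one_right hn'.le ht.2
    have h4 := Nat.floor_le (mul_nonneg hn'.le ht.1)
    have h5 := Nat.lt_floor_add_one ((n : ℝ) * t)
    have h6 : ⌊(n : ℝ) * t⌋₊ ≤ n := by exact_mod_cast h4.trans h3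
    have h7 : ⌊(n : ℝ) * t⌋₊ ≤ changeIndex t n + 1 ∧ changeIndex t n ≤ ⌊(n : ℝ) * t⌋₊ + 1 := by
      unfold changeIndex
      omega
    -- moving the index into the range lowers it only if `⌊n t⌋ = n`, that is `t = 1`
    have h7a : ⌊(n : ℝ) * t⌋₊ = n ∨ ⌊(n : ℝ) * t⌋₊ ≤ changeIndex t n := by
      unfold changeIndex
      omega
  · rw [le_div_iff₀ hn', sub_mul, one_div, inv_mul_cancel₀ hn'.ne']
    rcases h7a with h8 | h8
    · have h9 : (n : ℝ) ≤ changeIndex t n + 1 := by exact_mod_cast h8 ▸ h7.1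
      linarith
    · have h9 : (⌊(n : ℝ) * t⌋₊ : ℝ) ≤ changeIndex t n := by exact_mod_cast h8
      linarith
  · rw [div_le_iff₀ hn', add_mul, one_div, inv_mul_cancel₀ hn'.ne']
    have h9 : (changeIndex t n : ℝ) ≤ ⌊(n : ℝ) * t⌋₊ + 1 := by exact_mod_cast h7.2
    linarith

lemma sub_div_mem_Icc {n i k : ℕ} (hi : i ∈ Finset.Icc 1 n) (hk : k ∈ Finset.Ico 1 n) :
    ((i : ℝ) - k) / n ∈ Icc (-1 : ℝ) 1 := by
  rw [Finset.mem_Icc] at hi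
  rw [Finset.mem_Ico] at hk
  have hn : (0 : ℝ) < n := by exact_mod_cast (by omega : 0 < n)
  have h1 : (i : ℝ) ≤ n := by exact_mod_cast hi.2
  have h2 : (k : ℝ) ≤ n := by exact_mod_cast hk.2.le
  have h3 : (0 : ℝ) ≤ i := i.cast_nonneg
  have h4 : (0 : ℝ) ≤ k := k.cast_nonneg
  refine ⟨?_, ?_⟩
  · rw [le_div_iff₀ hn]; linarith
  · rw [div_le_iff₀ hn]; linarith

/-- Along the indices `changeIndex t n`, weighted averages of a bounded a.e. continuous function
converge to the corresponding integral. -/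
lemma tendsto_weightedAverage (hh : IsWeightFunction h) {t : ℝ} (ht : t ∈ Icc (0 : ℝ) 1)
    {f : ℝ → ℝ} {M : ℝ} (hfM : ∀ x ∈ Icc (0 : ℝ) 1, |f x| ≤ M)
    (hf : ∀ᵐ x : ℝ, x ∈ Ioc (0 : ℝ) 1 → ContinuousAt f x) :
    Tendsto (fun n : ℕ => (n : ℝ)⁻¹ * ∑ i ∈ Finset.Icc 1 n,
      h (((i : ℝ) - changeIndex t n) / n) * f ((i : ℝ) / n)) atTop
      (𝓝 (∫ x in (0 : ℝ)..1, h (x - t) * f x)) := by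
  obtain ⟨K, hK0, hK⟩ := hh.exists_bound
  have h1 := tendsto_riemannSum (u := fun n x => h (x - (changeIndex t n : ℝ) / n) * f x)
    (f := fun x => h (x - t) * f x) (M := K * M) ?_ ?_
  · simpa only [← sub_div] using h1
  · filter_upwards [eventually_ge_atTop 2] with n hn i hi
    rw [abs_mul, ← sub_div]
    have h2 := hK _ (sub_div_mem_Icc hi (changeIndex_mem (t := t) hn))
    have h3 : (i : ℝ) / n ∈ Icc (0 : ℝ) 1 := by
      rw [Finset.mem_Icc] at hi
      exact ⟨by positivity, div_le_one_of_le₀ (by exact_mod_cast hi.2) (by positivity)⟩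
    exact mul_le_mul h2 (hfM _ h3) (abs_nonneg _) hK0
  · filter_upwards [hf] with x hx hx01
    have h4 := tendsto_ceil_div hx01
    refine Tendsto.mul ?_ ((hx hx01).tendsto.comp h4)
    have h5 : x - t ∈ Icc (-1 : ℝ) 1 :=
      ⟨by linarith [hx01.1, ht.2], by linarith [hx01.2, ht.1]⟩
    refine (hh.continuousOn (x - t) h5).tendsto.comp
      (tendsto_nhdsWithin_iff.2 ⟨h4.sub (tendsto_changeIndex_div ht), ?_⟩)
    filter_upwards [eventually_ge_atTop 2] with n hn
    rw [← sub_div]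
    exact sub_div_mem_Icc (ceil_mem_Icc (by omega) hx01) (changeIndex_mem hn)

lemma tendsto_average {f : ℝ → ℝ} {M : ℝ} (hfM : ∀ x ∈ Icc (0 : ℝ) 1, |f x| ≤ M)
    (hf : ∀ᵐ x : ℝ, x ∈ Ioc (0 : ℝ) 1 → ContinuousAt f x) :
    Tendsto (fun n : ℕ => (n : ℝ)⁻¹ * ∑ i ∈ Finset.Icc 1 n, f ((i : ℝ) / n)) atTop
      (𝓝 (∫ x in (0 : ℝ)..1, f x)) := by
  refine tendsto_riemannSum (u := fun _ => f) (M := M) ?_ ?_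
  · refine Eventually.of_forall fun n i hi => hfM _ ?_
    rw [Finset.mem_Icc] at hi
    exact ⟨by positivity, div_le_one_of_le₀ (by exact_mod_cast hi.2) (by positivity)⟩
  · filter_upwards [hf] with x hx hx01
    exact (hx hx01).tendsto.comp (tendsto_ceil_div hx01)

/-- The coefficient with which `√n • Δ` enters the weighted sum with index `k`: the weighted
average of the centered values of `g`. -/
noncomputable def signalCoeff (h g : ℝ → ℝ) (n k : ℕ) : ℝ :=
  (n : ℝ)⁻¹ * ∑ i ∈ Finset.Icc 1 n, h (((i : ℝ) - k) / n) * g ((i : ℝ) / n) -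
    ((n : ℝ)⁻¹ * ∑ i ∈ Finset.Icc 1 n, g ((i : ℝ) / n)) *
      ((n : ℝ)⁻¹ * ∑ i ∈ Finset.Icc 1 n, h (((i : ℝ) - k) / n))

lemma tendsto_signalCoeff (hg : IsChangeFunction g) (hh : IsWeightFunction h) {t : ℝ}
    (ht : t ∈ Icc (0 : ℝ) 1) :
    Tendsto (fun n => signalCoeff h g n (changeIndex t n)) atTop
      (𝓝 ((∫ x in (0 : ℝ)..1, h (x - t) * g x) -
        (∫ x in (0 : ℝ)..1, g x) * ∫ x in (0 : ℝ)..1, h (x - t))) := by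
  obtain ⟨M, hM⟩ := hg.bounded
  have h1 := tendsto_weightedAverage hh ht (f := fun _ => 1) (M := 1) (by simp)
    (Eventually.of_forall fun _ _ => continuousAt_const)
  simp only [mul_one] at h1
  exact (tendsto_weightedAverage hh ht hM hg.ae_continuousAt).sub
    ((tendsto_average hM hg.ae_continuousAt).mul h1)

/-- A positive signal strength yields a point `t` at which the coefficients of the signal stay
away from zero. -/
lemma exists_signalCoeff_lower_bound (hg : IsChangeFunction g) (hh : IsWeightFunction h)
    (hdetect : 0 < signal h g) :
    ∃ t : ℝ, ∃ c > 0, ∀ᶠ n in atTop, c ≤ |signalCoeff h g n (changeIndex t n)| := by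
  obtain ⟨⟨t, ht⟩, h1⟩ := exists_lt_of_lt_ciSup hdetect
  refine ⟨t, _, half_pos h1, ?_⟩
  exact (tendsto_signalCoeff hg hh ht).abs.eventually_const_le (half_lt_self h1)

end Functions

/-! ### Second moments of weighted sums of the errors -/

section Noise

variable {H : Type*} [NormedAddCommGroup H] [InnerProductSpace ℝ H]
  [MeasurableSpace H]
  {Ω : Type*} [MeasurableSpace Ω] {P : Measure Ω} {ε : ℤ → Ω → H}

lemma IsWeaklyDependentNoise.identDistrib (hε : IsWeaklyDependentNoise ε P) (i j : ℤ) :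
    IdentDistrib (ε i) (ε j) P P := by
  refine ⟨(hε.measurable i).aemeasurable, (hε.measurable j).aemeasurable, ?_⟩
  have hm : ∀ m : ℤ, Measurable fun ω (l : ℤ) => ε (l + m) ω := fun m =>
    measurable_pi_lambda _ fun l => hε.measurable (l + m)
  have h1 := congrArg (fun Q => Q.map fun a : ℤ → H => a j) (hε.stationary (i - j))
  rw [Measure.map_map (measurable_pi_apply j) (hm _),
    Measure.map_map (measurable_pi_apply j) (measurable_pi_lambda _ hε.measurable)] at h1
  simpa [Function.comp_def] using h1

variable [SecondCountableTopology H] [BorelSpace H]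

/-- By stationarity, the covariance of two scores depends on the lag only. -/
lemma IsWeaklyDependentNoise.covariance_eq (hε : IsWeaklyDependentNoise ε P) (v : H) (i j : ℤ) :
    cov[fun ω => ⟪ε i ω, v⟫_ℝ, fun ω => ⟪ε j ω, v⟫_ℝ; P] =
      cov[fun ω => ⟪ε 0 ω, v⟫_ℝ, fun ω => ⟪ε (j - i) ω, v⟫_ℝ; P] := by
  have hm : ∀ m : ℤ, Measurable fun ω (l : ℤ) => ε (l + m) ω := fun m =>
    measurable_pi_lambda _ fun l => hε.measurable (l + m)
  have hX : ∀ l : ℤ, Measurable fun a : ℤ → H => ⟪a l, v⟫_ℝ := fun l =>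
    (measurable_pi_apply l).inner measurable_const
  have h1 := covariance_map (μ := P) (hX 0).aestronglyMeasurable (hX (j - i)).aestronglyMeasurable
    (hm i).aemeasurable
  have h2 := covariance_map (μ := P) (hX 0).aestronglyMeasurable (hX (j - i)).aestronglyMeasurable
    (measurable_pi_lambda _ hε.measurable).aemeasurable
  rw [hε.stationary i, h2] at h1
  simpa [Function.comp_def] using h1.symm

variable [IsProbabilityMeasure P]

lemma IsWeaklyDependentNoise.memLp_two (hε : IsWeaklyDependentNoise ε P) (i : ℤ) :
    MemLp (ε i) 2 P := by
  obtain ⟨k, hk, hint⟩ := hε.moment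
  have hk0 : (0 : ℝ) < k := by linarith
  have h1 : MemLp (ε 1) (ENNReal.ofReal k) P := by
    refine (integrable_norm_rpow_iff (hε.measurable 1).aestronglyMeasurable
      (by simpa using hk0) ENNReal.ofReal_ne_top).1 ?_
    rwa [ENNReal.toReal_ofReal hk0.le]
  refine (hε.identDistrib i 1).memLp_iff.2 (h1.mono_exponent ?_)
  rw [← ENNReal.ofReal_ofNat 2]
  exact ENNReal.ofReal_le_ofReal hk.le

lemma IsWeaklyDependentNoise.memLp_inner (hε : IsWeaklyDependentNoise ε P) (v : H) (i : ℤ) :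
    MemLp (fun ω => ⟪ε i ω, v⟫_ℝ) 2 P :=
  ((innerSL ℝ).flip v).comp_memLp' (hε.memLp_two i)

variable [CompleteSpace H]

lemma IsWeaklyDependentNoise.integral_inner_eq_zero (hε : IsWeaklyDependentNoise ε P) (v : H)
    (i : ℤ) : ∫ ω, ⟪ε i ω, v⟫_ℝ ∂P = 0 := by
  have h1 := ((innerSL ℝ).flip v).integral_comp_comm
    ((hε.memLp_two i).integrable one_le_two)
  rw [hε.centered i, map_zero] at h1
  exact h1

/-- The second moment of a score of a weighted sum of `n` errors grows at most linearly in `n`. -/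
lemma IsWeaklyDependentNoise.integral_inner_sum_sq_le (hε : IsWeaklyDependentNoise ε P) (v : H)
    (hv : Summable fun r : ℤ => |cov[fun ω => ⟪ε 0 ω, v⟫_ℝ, fun ω => ⟪ε r ω, v⟫_ℝ; P]|)
    {n : ℕ} {a : ℕ → ℝ} {K : ℝ} (ha : ∀ i ∈ Finset.Icc 1 n, |a i| ≤ K) (hK : 0 ≤ K) :
    ∫ ω, ⟪∑ i ∈ Finset.Icc 1 n, a i • ε i ω, v⟫_ℝ ^ 2 ∂P ≤
      K ^ 2 * n * ∑' r : ℤ, |cov[fun ω => ⟪ε 0 ω, v⟫_ℝ, fun ω => ⟪ε r ω, v⟫_ℝ; P]| := by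
  set γ : ℤ → ℝ := fun r => cov[fun ω => ⟪ε 0 ω, v⟫_ℝ, fun ω => ⟪ε r ω, v⟫_ℝ; P]
  have hexp : ∀ ω, ⟪∑ i ∈ Finset.Icc 1 n, a i • ε i ω, v⟫_ℝ =
      ∑ i ∈ Finset.Icc 1 n, a i * ⟪ε i ω, v⟫_ℝ := fun ω => by
    simp [sum_inner, inner_smul_left]
  simp only [hexp]
  have hL : ∀ i : ℕ, MemLp (fun ω => a i * ⟪ε i ω, v⟫_ℝ) 2 P := fun i =>
    (hε.memLp_inner v i).const_mul (a i)
  have hLs : MemLp (fun ω => ∑ i ∈ Finset.Icc 1 n, a i * ⟪ε i ω, v⟫_ℝ) 2 P :=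
    memLp_finsetSum _ fun i _ => hL i
  have h0 : ∫ ω, ∑ i ∈ Finset.Icc 1 n, a i * ⟪ε i ω, v⟫_ℝ ∂P = 0 := by
    rw [integral_finsetSum _ fun i _ => (hL i).integrable one_le_two]
    simp [integral_const_mul, hε.integral_inner_eq_zero]
  have h1 := variance_of_integral_eq_zero hLs.aemeasurable h0
  rw [← covariance_self hLs.aemeasurable,
    covariance_fun_sum_fun_sum' (fun i _ => hL i) (fun i _ => hL i)] at h1
  simp only [covariance_const_mul_left, covariance_const_mul_right] at h1
  refine h1.symm.trans_le ?_
  calc ∑ i ∈ Finset.Icc 1 n, ∑ j ∈ Finset.Icc 1 n,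
        a j * (a i * cov[fun ω => ⟪ε i ω, v⟫_ℝ, fun ω => ⟪ε j ω, v⟫_ℝ; P])
      ≤ ∑ i ∈ Finset.Icc 1 n, ∑ j ∈ Finset.Icc 1 n, K * (K * |γ ((j : ℤ) - i)|) := by
        refine Finset.sum_le_sum fun i hi => Finset.sum_le_sum fun j hj => ?_
        refine (le_abs_self _).trans ?_
        rw [hε.covariance_eq v i j, abs_mul, abs_mul]
        gcongr
        · exact ha j hj
        · exact ha i hi
    _ ≤ ∑ i ∈ Finset.Icc 1 n, K * (K * ∑' r : ℤ, |γ r|) := by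
        refine Finset.sum_le_sum fun i _ => ?_
        rw [← Finset.mul_sum, ← Finset.mul_sum]
        gcongr
        have hinj : Function.Injective fun j : ℕ => (j : ℤ) - i := fun j l hjl => by
          simpa using hjl
        rw [← Finset.sum_image (f := fun r : ℤ => |γ r|) (g := fun j : ℕ => (j : ℤ) - i)
          (fun j _ l _ hjl => hinj hjl)]
        exact hv.sum_le_tsum _ fun r _ => abs_nonneg _
    _ = K ^ 2 * n * ∑' r : ℤ, |γ r| := by
        simp
        ring

/-- Weighted sums of `n` errors with bounded weights have second moments of order `n`: by
Parseval's identity, these are the sums of the second moments of the scores. -/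
lemma IsWeaklyDependentNoise.exists_lintegral_le (hε : IsWeaklyDependentNoise ε P) :
    ∃ Γ : ℝ, ∀ (n : ℕ) (a : ℕ → ℝ) (K : ℝ), (∀ i ∈ Finset.Icc 1 n, |a i| ≤ K) → 0 ≤ K →
      ∫⁻ ω, ENNReal.ofReal (‖∑ i ∈ Finset.Icc 1 n, a i • ε i ω‖ ^ 2) ∂P ≤
        ENNReal.ofReal (K ^ 2 * n * Γ) := by
  obtain ⟨s, v, -, -, hsum⟩ := hε.spectral
  let γ : s → ℤ → ℝ := fun p r =>
    |cov[fun ω => ⟪ε 0 ω, v p⟫_ℝ, fun ω => ⟪ε r ω, v p⟫_ℝ; P]|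
  have hγ : ∀ p, Summable (γ p) := fun p => hsum.prod_factor p
  have hγ' : Summable fun p => ∑' r, γ p r := hsum.prod
  refine ⟨∑' p, ∑' r, γ p r, fun n a K ha hK => ?_⟩
  set Y : Ω → H := fun ω => ∑ i ∈ Finset.Icc 1 n, a i • ε i ω
  have hYm : Measurable Y := Finset.measurable_fun_sum _ fun i _ => (hε.measurable i).const_smul (a i)
  have hYL : MemLp Y 2 P := memLp_finsetSum _ fun i _ => (hε.memLp_two i).const_smul (a i)
  have hparseval : ∀ ω, ENNReal.ofReal (‖Y ω‖ ^ 2) =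
      ∑' p : s, ENNReal.ofReal (⟪Y ω, v p⟫_ℝ ^ 2) := fun ω => by
    have h1 := v.hasSum_inner_mul_inner (Y ω) (Y ω)
    simp only [real_inner_comm (Y ω) (v _), ← sq, real_inner_self_eq_norm_sq] at h1
    rw [← h1.tsum_eq, ENNReal.ofReal_tsum_of_nonneg (fun p => sq_nonneg _) h1.summable]
  calc ∫⁻ ω, ENNReal.ofReal (‖Y ω‖ ^ 2) ∂P
      = ∫⁻ ω, ∑' p : s, ENNReal.ofReal (⟪Y ω, v p⟫_ℝ ^ 2) ∂P := by simp only [hparseval]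
    _ = ∑' p : s, ∫⁻ ω, ENNReal.ofReal (⟪Y ω, v p⟫_ℝ ^ 2) ∂P :=
        lintegral_tsum fun p =>
          ((hYm.inner measurable_const).pow_const 2).ennreal_ofReal.aemeasurable
    _ ≤ ∑' p : s, ENNReal.ofReal (K ^ 2 * n * ∑' r, γ p r) := by
        refine ENNReal.tsum_le_tsum fun p => ?_
        have hL : MemLp (fun ω => ⟪Y ω, v p⟫_ℝ) 2 P := ((innerSL ℝ).flip (v p)).comp_memLp' hYL
        rw [← ofReal_integral_eq_lintegral_ofReal hL.integrable_sq
          (Eventually.of_forall fun _ => sq_nonneg _)]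
        exact ENNReal.ofReal_le_ofReal (hε.integral_inner_sum_sq_le (v p) (hγ p) ha hK)
    _ = ENNReal.ofReal (K ^ 2 * n * ∑' p, ∑' r, γ p r) := by
        rw [← ENNReal.ofReal_tsum_of_nonneg, tsum_mul_left]
        · exact fun p => mul_nonneg (by positivity) (tsum_nonneg fun r => abs_nonneg _)
        · exact hγ'.mul_left _

end Noise

/-! ### Signal and noise parts of the weighted sums -/

section Decomposition

variable {H : Type*} [NormedAddCommGroup H] [InnerProductSpace ℝ H]

/-- The weights `h((i - k)/n)`, centered to have mean zero over `1 ≤ i ≤ n`. -/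
noncomputable def centeredWeight (h : ℝ → ℝ) (n k i : ℕ) : ℝ :=
  h (((i : ℝ) - k) / n) - (n : ℝ)⁻¹ * ∑ j ∈ Finset.Icc 1 n, h (((j : ℝ) - k) / n)

/-- Centering the observations amounts to centering the weights. -/
lemma weightedSum_eq (h : ℝ → ℝ) (n k : ℕ) (x : ℕ → H) :
    weightedSum h n x k =
      (√(n : ℝ))⁻¹ • ∑ i ∈ Finset.Icc 1 n, centeredWeight h n k i • x i := by
  unfold weightedSum centeredWeight sampleMean
  congr 1
  simp only [smul_sub, sub_smul, Finset.sum_sub_distrib]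
  rw [← Finset.sum_smul, ← Finset.smul_sum, smul_smul, mul_comm]

lemma sum_centeredWeight {h : ℝ → ℝ} {n : ℕ} (hn : 0 < n) (k : ℕ) :
    ∑ i ∈ Finset.Icc 1 n, centeredWeight h n k i = 0 := by
  have hn' : (n : ℝ) ≠ 0 := by positivity
  unfold centeredWeight
  rw [Finset.sum_sub_distrib, Finset.sum_const, Nat.card_Icc, Nat.add_sub_cancel, nsmul_eq_mul,
    mul_inv_cancel_left₀ hn', sub_self]

lemma abs_centeredWeight_le {h : ℝ → ℝ} {n k : ℕ} {K : ℝ}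
    (hK : ∀ i ∈ Finset.Icc 1 n, |h (((i : ℝ) - k) / n)| ≤ K) {i : ℕ} (hi : i ∈ Finset.Icc 1 n) :
    |centeredWeight h n k i| ≤ 2 * K := by
  have hn : (0 : ℝ) < n := by
    rw [Finset.mem_Icc] at hi
    exact_mod_cast (by omega : 0 < n)
  have h1 : |∑ j ∈ Finset.Icc 1 n, h (((j : ℝ) - k) / n)| ≤ n * K := by
    refine (Finset.abs_sum_le_sum_abs _ _).trans ((Finset.sum_le_card_nsmul _ _ _ hK).trans_eq ?_)
    simp
  have h2 : |(n : ℝ)⁻¹ * ∑ j ∈ Finset.Icc 1 n, h (((j : ℝ) - k) / n)| ≤ K := by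
    rw [abs_mul, abs_of_pos (inv_pos.2 hn), inv_mul_le_iff₀ hn]
    exact h1
  exact (abs_sub _ _).trans (by linarith [hK i hi])

/-- The weighted sum splits into the signal `√n • signalCoeff • d` and the weighted sum of the
errors; the mean `m` drops out. -/
lemma weightedSum_signal_add_noise {h g : ℝ → ℝ} {n : ℕ} (hn : 0 < n) (k : ℕ) (m d : H)
    {e x : ℕ → H} (hx : ∀ i ∈ Finset.Icc 1 n, x i = m + g ((i : ℝ) / n) • d + e i) :
    weightedSum h n x k = (√(n : ℝ) * signalCoeff h g n k) • d + weightedSum h n e k := by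
  have hn' : (0 : ℝ) < n := Nat.cast_pos.2 hn
  have h1 : ∑ i ∈ Finset.Icc 1 n, centeredWeight h n k i • x i =
      (∑ i ∈ Finset.Icc 1 n, centeredWeight h n k i) • m +
      (∑ i ∈ Finset.Icc 1 n, centeredWeight h n k i * g ((i : ℝ) / n)) • d +
      ∑ i ∈ Finset.Icc 1 n, centeredWeight h n k i • e i := by
    rw [Finset.sum_smul, Finset.sum_smul, ← Finset.sum_add_distrib, ← Finset.sum_add_distrib]
    refine Finset.sum_congr rfl fun i hi => ?_
    rw [hx i hi, smul_add, smul_add, smul_smul]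
  have h2 : ∑ i ∈ Finset.Icc 1 n, centeredWeight h n k i * g ((i : ℝ) / n) =
      n * signalCoeff h g n k := by
    unfold centeredWeight signalCoeff
    simp only [sub_mul, Finset.sum_sub_distrib]
    rw [← Finset.mul_sum, mul_sub, mul_inv_cancel_left₀ hn'.ne']
    field_simp
  rw [weightedSum_eq, weightedSum_eq, h1, sum_centeredWeight hn, zero_smul, zero_add, h2, smul_add,
    smul_smul, ← mul_assoc]
  congr 3
  rw [inv_mul_eq_div, Real.div_sqrt]

lemma norm_weightedSum_le_statFF (h : ℝ → ℝ) {n k : ℕ} (hk : k ∈ Finset.Ico 1 n) (x : ℕ → H) :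
    ‖weightedSum h n x k‖ ≤ statFF h n x :=
  le_ciSup (f := fun k : Finset.Ico 1 n => ‖weightedSum h n x k‖) (finite_range _).bddAbove ⟨k, hk⟩

lemma norm_invSqrt_weightedSum_le_statWF [CompleteSpace H] (h : ℝ → ℝ) (C : H →L[ℝ] H) {n k : ℕ}
    (hk : k ∈ Finset.Ico 1 n) (x : ℕ → H) :
    ‖invSqrt (regularized C) (weightedSum h n x k)‖ ≤ statWF h C n x :=
  le_ciSup (f := fun k : Finset.Ico 1 n => ‖invSqrt (regularized C) (weightedSum h n x k)‖)
    (finite_range _).bddAbove ⟨k, hk⟩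

end Decomposition

/-! ### Divergence of the statistics -/

section Divergence

variable {H : Type*} [NormedAddCommGroup H] [InnerProductSpace ℝ H] [CompleteSpace H]
  {Ω : Type*} [MeasurableSpace Ω] {P : Measure Ω}

section WeightedSums

variable [SecondCountableTopology H] [MeasurableSpace H] [BorelSpace H] [IsProbabilityMeasure P]
  {ε : ℤ → Ω → H} {g h : ℝ → ℝ}

/-- Chebyshev's inequality for the weighted sums of the errors, uniformly in `1 ≤ k < n`. -/
lemma IsWeaklyDependentNoise.exists_measure_weightedSum_le (hε : IsWeaklyDependentNoise ε P)
    (hh : IsWeightFunction h) :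
    ∃ D : ℝ, ∀ n : ℕ, ∀ k ∈ Finset.Ico 1 n, ∀ r > 0,
      P {ω | r ≤ ‖weightedSum h n (fun i => ε i ω) k‖} ≤ ENNReal.ofReal (D / r ^ 2) := by
  obtain ⟨K, hK0, hK⟩ := hh.exists_bound
  obtain ⟨Γ, hΓ⟩ := hε.exists_lintegral_le
  refine ⟨(2 * K) ^ 2 * Γ, fun n k hk r hr => ?_⟩
  have hn : (0 : ℝ) < n := by
    rw [Finset.mem_Ico] at hk
    exact_mod_cast (by omega : 0 < n)
  have h1 := hΓ n (centeredWeight h n k) (2 * K)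
    (fun i hi => abs_centeredWeight_le (fun j hj => hK _ (sub_div_mem_Icc hj hk)) hi)
    (by positivity)
  have hmeas : Measurable fun ω => ∑ i ∈ Finset.Icc 1 n, centeredWeight h n k i • ε i ω :=
    Finset.measurable_fun_sum _ fun i _ => (hε.measurable i).const_smul (centeredWeight h n k i)
  have hpos : 0 < n * r ^ 2 := by positivity
  have h2 := meas_ge_le_lintegral_div (μ := P)
    (hmeas.norm.pow_const 2).ennreal_ofReal.aemeasurable (ENNReal.ofReal_pos.2 hpos).ne'
    ENNReal.ofReal_ne_top
  have h3 : P {ω | r ≤ ‖weightedSum h n (fun i => ε i ω) k‖} ≤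
      P {ω | ENNReal.ofReal (n * r ^ 2) ≤
        ENNReal.ofReal (‖∑ i ∈ Finset.Icc 1 n, centeredWeight h n k i • ε i ω‖ ^ 2)} := by
    refine measure_mono fun ω hω => ENNReal.ofReal_le_ofReal ?_
    rw [mem_ofPred_eq, weightedSum_eq, norm_smul, norm_inv, Real.norm_of_nonneg (Real.sqrt_nonneg _),
      le_inv_mul_iff₀ (Real.sqrt_pos.2 hn)] at hω
    calc n * r ^ 2 = (√(n : ℝ) * r) ^ 2 := by rw [mul_pow, Real.sq_sqrt hn.le]
      _ ≤ _ := by gcongr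
  refine (h3.trans h2).trans ((ENNReal.div_le_div_right h1 _).trans_eq ?_)
  rw [← ENNReal.ofReal_div_of_pos hpos]
  congr 1
  field_simp

/-- Along suitable indices `k n`, the weighted sum is at least of order `√n ‖Δ n‖` with
probability tending to one: the signal is of this order and the noise is bounded in probability. -/
lemma exists_tendsto_measure_weightedSum_le (hε : IsWeaklyDependentNoise ε P)
    (hg : IsChangeFunction g) (hh : IsWeightFunction h) (hdetect : 0 < signal h g)
    (m : H) {Δ : ℕ → H} (hΔ : Tendsto (fun n : ℕ => √(n : ℝ) * ‖Δ n‖) atTop atTop)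
    {X : ℕ → ℕ → Ω → H}
    (hX : ∀ n, ∀ i ∈ Finset.Icc 1 n, ∀ ω, X n i ω = m + g ((i : ℝ) / n) • Δ n + ε (i : ℤ) ω) :
    ∃ (k : ℕ → ℕ) (c : ℝ), 0 < c ∧ (∀ n ≥ 2, k n ∈ Finset.Ico 1 n) ∧
      Tendsto (fun n => P {ω | ‖weightedSum h n (fun i => X n i ω) (k n)‖ ≤
        c * (√(n : ℝ) * ‖Δ n‖)}) atTop (𝓝 0) := by
  obtain ⟨t, c, hc, hlow⟩ := exists_signalCoeff_lower_bound hg hh hdetect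
  obtain ⟨D, hD⟩ := hε.exists_measure_weightedSum_le hh
  refine ⟨changeIndex t, c / 2, half_pos hc, fun n hn => changeIndex_mem hn, ?_⟩
  have hlim : Tendsto (fun n : ℕ => ENNReal.ofReal (D / (c / 2 * (√(n : ℝ) * ‖Δ n‖)) ^ 2)) atTop
      (𝓝 0) := by
    have h1 : Tendsto (fun n : ℕ => (c / 2 * (√(n : ℝ) * ‖Δ n‖)) ^ 2) atTop atTop :=
      (tendsto_pow_atTop two_ne_zero).comp (hΔ.const_mul_atTop (half_pos hc))
    simpa using ENNReal.tendsto_ofReal (h1.const_div_atTop D)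
  refine tendsto_of_tendsto_of_tendsto_of_le_of_le' tendsto_const_nhds hlim
    (Eventually.of_forall fun _ => zero_le) ?_
  filter_upwards [hlow, eventually_ge_atTop 2, hΔ.eventually_gt_atTop 0] with n hn hn2 hpos
  refine (measure_mono fun ω hω => ?_).trans
    (hD n _ (changeIndex_mem (t := t) hn2) (c / 2 * (√(n : ℝ) * ‖Δ n‖)) (by positivity))
  rw [mem_ofPred_eq, weightedSum_signal_add_noise (by omega : 0 < n) _ m (Δ n)
    (fun i hi => hX n i hi ω)] at hω
  set E := weightedSum h n (fun i => ε i ω) (changeIndex t n)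
  have h1 : ‖(√(n : ℝ) * signalCoeff h g n (changeIndex t n)) • Δ n‖ =
      |signalCoeff h g n (changeIndex t n)| * (√(n : ℝ) * ‖Δ n‖) := by
    rw [norm_smul, norm_mul, Real.norm_of_nonneg (Real.sqrt_nonneg _), Real.norm_eq_abs]
    ring
  have h2 := norm_sub_le_norm_add ((√(n : ℝ) * signalCoeff h g n (changeIndex t n)) • Δ n) E
  rw [h1] at h2
  have h3 := mul_le_mul_of_nonneg_right hn hpos.le
  rw [mem_ofPred_eq]
  linarith

end WeightedSums

lemma tendstoInProbAtTop_of_tendsto_measure_le {S : ℕ → Ω → ℝ} {b : ℕ → ℝ}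
    (hb : Tendsto b atTop atTop) (hS : Tendsto (fun n => P {ω | S n ω ≤ b n}) atTop (𝓝 0)) :
    TendstoInProbAtTop S P := by
  intro M
  refine tendsto_of_tendsto_of_tendsto_of_le_of_le' tendsto_const_nhds hS
    (Eventually.of_forall fun _ => zero_le) ?_
  filter_upwards [hb.eventually_ge_atTop M] with n hM
  exact measure_mono fun ω hω => le_trans hω hM

lemma TendstoInProbAtTop.mono {S T : ℕ → Ω → ℝ} (hS : TendstoInProbAtTop S P)
    (hST : ∀ᶠ n in atTop, ∀ ω, S n ω ≤ T n ω) : TendstoInProbAtTop T P := by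
  intro M
  refine tendsto_of_tendsto_of_tendsto_of_le_of_le' tendsto_const_nhds (hS M)
    (Eventually.of_forall fun _ => zero_le) ?_
  filter_upwards [hST] with n hn
  exact measure_mono fun ω hω => (hn ω).trans hω

/-- If `‖v n‖` exceeds a multiple of `a n` with probability tending to one and
`‖C n‖ = o_P((a n)²)`, then the norm of `(C n + λ₁ Id)^{-1/2} v n` tends to infinity in
probability. -/
lemma tendstoInProbAtTop_norm_invSqrt {v : ℕ → Ω → H} {C : ℕ → Ω → H →L[ℝ] H} {a : ℕ → ℝ} {c : ℝ}
    (hc : 0 < c) (ha : ∀ᶠ n in atTop, 0 < a n)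
    (hv : Tendsto (fun n => P {ω | ‖v n ω‖ ≤ c * a n}) atTop (𝓝 0))
    (hadm : Tendsto (fun n => P {ω | ¬ IsAdmissible (C n ω)}) atTop (𝓝 0))
    (hC : IsLittleOInProb (fun n ω => ‖C n ω‖) (fun n => a n ^ 2) P) :
    TendstoInProbAtTop (fun n ω => ‖invSqrt (regularized (C n ω)) (v n ω)‖) P := by
  intro M
  -- `δ` is chosen so that `2 δ a² M² ≤ c² a²`
  set δ : ℝ := c ^ 2 / (2 * (M ^ 2 + 1)) with hδ
  have hδ0 : 0 < δ := by positivity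
  have hlim := (hv.add hadm).add (hC δ hδ0)
  simp only [add_zero] at hlim
  refine tendsto_of_tendsto_of_tendsto_of_le_of_le' tendsto_const_nhds hlim
    (Eventually.of_forall fun _ => zero_le) ?_
  filter_upwards [ha] with n hn
  refine (measure_mono (fun ω hω => ?_)).trans ((measure_union_le _ _).trans
    (add_le_add_left (measure_union_le _ _) _))
  by_contra hcon
  simp only [mem_union, mem_ofPred_eq, not_or, not_le, not_not, not_lt, abs_norm] at hcon hω
  obtain ⟨⟨h1, h2⟩, h3⟩ := hcon
  rw [abs_of_pos (by positivity : 0 < a n ^ 2)] at h3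
  have h4 := norm_sq_le_opNorm_mul_norm_invSqrt_sq h2.positive h2.invertible (v n ω)
  have h5 := norm_regularized_le h2
  have h6 : (c * a n) ^ 2 < ‖v n ω‖ ^ 2 := by gcongr
  have h7 : ‖invSqrt (regularized (C n ω)) (v n ω)‖ ^ 2 ≤ M ^ 2 := by gcongr
  have h8 : ‖regularized (C n ω)‖ * ‖invSqrt (regularized (C n ω)) (v n ω)‖ ^ 2 ≤
      2 * (δ * a n ^ 2) * M ^ 2 :=
    mul_le_mul (h5.trans (by linarith)) h7 (by positivity) (by positivity)
  have h9 : 2 * (δ * a n ^ 2) * M ^ 2 ≤ (c * a n) ^ 2 := by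
    have h10 : 2 * δ * (M ^ 2 + 1) = c ^ 2 := by
      rw [hδ]
      field_simp
    have h11 : 0 ≤ δ * a n ^ 2 := by positivity
    calc 2 * (δ * a n ^ 2) * M ^ 2 ≤ 2 * (δ * a n ^ 2) * (M ^ 2 + 1) := by gcongr; linarith
      _ = 2 * δ * (M ^ 2 + 1) * a n ^ 2 := by ring
      _ = _ := by rw [h10, mul_pow]
  linarith

end Divergence

end GradualChange

theorem mainTheorem6
    {Z : Type*} [MeasurableSpace Z] (ν : Measure Z) [SigmaFinite ν]
    [TopologicalSpace.SeparableSpace (Lp ℝ 2 ν)]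
    [MeasurableSpace (Lp ℝ 2 ν)] [BorelSpace (Lp ℝ 2 ν)]
    {Ω : Type*} [MeasurableSpace Ω] (P : Measure Ω) [IsProbabilityMeasure P]
    {Ω' : Type*} [MeasurableSpace Ω'] (P' : Measure Ω') [IsProbabilityMeasure P']
    (ε : ℤ → Ω → Lp ℝ 2 ν) (hε : IsWeaklyDependentNoise ε P)
    (W : Ω' → CadlagPath (Lp ℝ 2 ν)) (hW : IsBrownianMotion W (longRunCov ε P) P')
    (hFCLT : TendstoInDistribution (fun n : ℕ => partialSumProcess ε n) atTop W (fun _ => P) P')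
    (g : ℝ → ℝ) (hg : IsChangeFunction g)
    (h : ℝ → ℝ) (hh : IsWeightFunction h)
    (hdetect : 0 < signal h g)
    (μ : Lp ℝ 2 ν) (Δ : ℕ → Lp ℝ 2 ν)
    (hΔ : Tendsto (fun n : ℕ => √(n : ℝ) * ‖Δ n‖) atTop atTop)
    (X : ℕ → ℕ → Ω → Lp ℝ 2 ν)
    (hX : ∀ n, ∀ i ∈ Finset.Icc 1 n, ∀ ω, X n i ω = μ + g ((i : ℝ) / n) • Δ n + ε (i : ℤ) ω) :
    TendstoInProbAtTop (fun n ω => statFF h n fun i => X n i ω) P ∧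
    ∀ Chat : ℕ → Ω → (Lp ℝ 2 ν →L[ℝ] Lp ℝ 2 ν),
      Tendsto (fun n => P {ω | ¬ IsAdmissible (Chat n ω)}) atTop (𝓝 0) →
      IsLittleOInProb (fun n ω => ‖Chat n ω‖) (fun n => n * ‖Δ n‖ ^ 2) P →
      TendstoInProbAtTop (fun n ω => statWF h (Chat n ω) n fun i => X n i ω) P := by
  have : SecondCountableTopology (Lp ℝ 2 ν) :=
    UniformSpace.secondCountable_of_separable (Lp ℝ 2 ν)
  obtain ⟨k, c, hc, hk, hlim⟩ :=
    exists_tendsto_measure_weightedSum_le hε hg hh hdetect μ hΔ hX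
  refine ⟨?_, fun Chat hadm hC => ?_⟩
  · refine (tendstoInProbAtTop_of_tendsto_measure_le (hΔ.const_mul_atTop hc) hlim).mono ?_
    filter_upwards [eventually_ge_atTop 2] with n hn ω
    exact norm_weightedSum_le_statFF h (hk n hn) _
  · have hC' : IsLittleOInProb (fun n ω => ‖Chat n ω‖) (fun n => (√(n : ℝ) * ‖Δ n‖) ^ 2) P := by
      simpa only [mul_pow, Real.sq_sqrt (Nat.cast_nonneg _)] using hC
    refine (tendstoInProbAtTop_norm_invSqrt hc (hΔ.eventually_gt_atTop 0) hlim hadm hC').mono ?_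
    filter_upwards [eventually_ge_atTop 2] with n hn ω
    exact norm_invSqrt_weightedSum_le_statWF h (Chat n ω) (hk n hn) _
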